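/- Let $d\ge 3$, let $\mathfrak g=\mathrm M_d(\mathbb C)$ be the Lie algebra of complex $d\times d$ matrices with standard basis $(e_{ij})$, and let $\mathcal U(\mathfrak g)$ be its universal enveloping algebra, with coproduct $\Delta$ (the algebra morphism $\mathcal U(\mathfrak g)\to\mathcal U(\mathfrak g)\otimes\mathcal U(\mathfrak g)$ with $\Delta(x)=1\otimes x+x\otimes 1$ for $x\in\mathfrak g$). Let $\rho$ be the standard representation of $\mathfrak g$ on $\mathbb C^d$, $\operatorname{tr}=\frac1d\operatorname{Tr}$, and let $\omega=\operatorname{tr}^{\otimes\infty}$ be the product state on the von Neumann algebra $\mathcal W=\mathrm M_d(\mathbb C)^{\otimes\infty}$, in which $\mathrm M_d(\mathbb C)^{\otimes n}$ is identified with $\mathrm M_d(\mathbb C)^{\otimes n}\otimes I^{\otimes\infty}$. For $n\ge1$ let $j_n=\rho^{\otimes n}:\mathcal U(\mathfrak g)\to\mathrm M_d(\mathbb C)^{\otimes n}\subset\mathcal W$, where $\rho^{\otimes n}=(\rho^{\otimes (n-1)}\otimes\rho)\circ\Delta$ and $\rho^{\otimes 1}=\rho$, and let $P=(\mathrm{id}\otimes(\operatorname{tr}\circ\rho))\circ\Delta:\mathcal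 U(\mathfrak g)\to\mathcal U(\mathfrak g)$. For a subalgebra $\mathcal A$ of $\mathcal U(\mathfrak g)$, say that the restriction of $(j_n)_{n\ge1}$ to $\mathcal A$ defines a quantum Markov process if there is a linear map $Q:\mathcal A\to\mathcal A$ such that \[\omega(j_{n+1}(x)\,\xi)=\omega(j_n(Qx)\,\xi)\] for all $n\ge1$, all $x\in\mathcal A$ and all $\xi$ in the von Neumann algebra generated by $\{j_k(\mathcal A),\,1\le k\le n\}$. (For $\mathcal A=\mathcal U(\mathfrak g)$ this holds with $Q=P$, hence also for every $\mathcal A$ with $P\mathcal A\subset\mathcal A$, with $Q=P|_{\mathcal A}$.) Partition the matrix $E=(e_{ij})_{1\le i,j\le d}$, with entries in $\mathcal U(\mathfrak g)$, into blocks $E_{rs}$, $1\le r,s\le 3$, according to $d=(d-2)+1+1$; thus $E_{11}$ is the upper left $(d-2)\times(d-2)$ block. Write $\mathbf{Tr}(M)=\sum_i m_{ii}$ for a square matrix $M$ with entries in $\mathcal U(\mathfrak g)$, and let $\mathcal B$ be the subalgebra of $\mathcal U(\mathfrak g)$ generated by the constants and the elements \[\mathbf{Tr}(E_{11}^k),\qquad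 \mathbf{Tr}\left(\begin{bmatrix}E_{11}&E_{12}\\E_{21}&E_{22}\end{bmatrix}^k\right),\qquad \mathbf{Tr}(E^k),\qquad k\in\mathbb N.\] Then the restriction of $(j_n)_{n\ge1}$ to $\mathcal B$ does not define a quantum Markov process. Moreover, the element $a=E_{21}E_{12}\,(E_{31}E_{13}+E_{32}E_{23})^2$ lies in $\mathcal B$, whereas $Pa\notin\mathcal B$; in particular $\mathcal B$ is not stable under $P$. -/

import Mathlib

attribute [local instance 100] LieRing.ofAssociativeRing

open scoped TensorProduct Kronecker

noncomputable section

namespace QuantumMinors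

/-! ### The enveloping algebra of `𝔤𝔩_d(ℂ)`, its coproduct, and the Markov operator -/

/-- The universal enveloping algebra of the Lie algebra `𝔤 = M_d(ℂ)`. -/
abbrev U (d : ℕ) : Type := UniversalEnvelopingAlgebra ℂ (Matrix (Fin d) (Fin d) ℂ)

/-- The generator `e_{ij}` of `U d`. -/
def e (d : ℕ) (i j : Fin d) : U d :=
  UniversalEnvelopingAlgebra.ι ℂ (Matrix.single i j (1 : ℂ))

/-- The standard representation `ρ` of `𝔤` on `ℂ^d`, extended to `U d`. -/
def rho (d : ℕ) : U d →ₐ[ℂ] Matrix (Fin d) (Fin d) ℂ :=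
  UniversalEnvelopingAlgebra.lift ℂ LieHom.id

/-- The Lie algebra morphism `x ↦ 1 ⊗ x + x ⊗ 1`. -/
def primitive (d : ℕ) : Matrix (Fin d) (Fin d) ℂ →ₗ⁅ℂ⁆ U d ⊗[ℂ] U d :=
  { (((Algebra.TensorProduct.includeRight : U d →ₐ[ℂ] U d ⊗[ℂ] U d).toLinearMap +
      (Algebra.TensorProduct.includeLeft : U d →ₐ[ℂ] U d ⊗[ℂ] U d).toLinearMap).comp
      (UniversalEnvelopingAlgebra.ι ℂ).toLinearMap) with
    map_lie' := by
      intro x y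
      change 1 ⊗ₜ[ℂ] UniversalEnvelopingAlgebra.ι ℂ ⁅x, y⁆ +
        UniversalEnvelopingAlgebra.ι ℂ ⁅x, y⁆ ⊗ₜ[ℂ] 1 =
          ⁅(1 : U d) ⊗ₜ[ℂ] UniversalEnvelopingAlgebra.ι ℂ x +
            UniversalEnvelopingAlgebra.ι ℂ x ⊗ₜ[ℂ] (1 : U d),
          (1 : U d) ⊗ₜ[ℂ] UniversalEnvelopingAlgebra.ι ℂ y +
            UniversalEnvelopingAlgebra.ι ℂ y ⊗ₜ[ℂ] (1 : U d)⁆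
      rw [LieHom.map_lie]
      simp only [LieRing.of_associative_ring_bracket, mul_add, add_mul,
        Algebra.TensorProduct.tmul_mul_tmul, one_mul, mul_one,
        TensorProduct.tmul_sub, TensorProduct.sub_tmul]
      abel }

theorem primitive_apply (d : ℕ) (x : Matrix (Fin d) (Fin d) ℂ) :
    primitive d x = 1 ⊗ₜ[ℂ] UniversalEnvelopingAlgebra.ι ℂ x +
      UniversalEnvelopingAlgebra.ι ℂ x ⊗ₜ[ℂ] 1 := rfl

/-- The coproduct `Δ : U d → U d ⊗ U d`. -/
def coproduct (d : ℕ) : U d →ₐ[ℂ] U d ⊗[ℂ] U d :=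
  UniversalEnvelopingAlgebra.lift ℂ (primitive d)

/-- The linear form `η = tr ∘ ρ`, with `tr = (1/d) Tr` the normalized trace on `M_d(ℂ)`. -/
def eta (d : ℕ) : U d →ₗ[ℂ] ℂ :=
  (d : ℂ)⁻¹ • (Matrix.traceLinearMap (Fin d) ℂ ℂ).comp (rho d).toLinearMap

/-- The Markov operator `P = (id ⊗ η) ∘ Δ`. -/
def P (d : ℕ) : U d →ₗ[ℂ] U d :=
  (TensorProduct.rid ℂ (U d)).toLinearMap.comp
    (((eta d).lTensor (U d)).comp (coproduct d).toLinearMap)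

/-! ### The quantum random walk -/

/-- The set indexing the standard basis of `(ℂ^d)^{⊗ n}`. -/
def Idx (d : ℕ) : ℕ → Type
  | 0 => Unit
  | n + 1 => Idx d n × Fin d

instance Idx.instFintype (d : ℕ) : (n : ℕ) → Fintype (Idx d n)
  | 0 => inferInstanceAs (Fintype Unit)
  | n + 1 =>
    haveI := Idx.instFintype d n
    inferInstanceAs (Fintype (Idx d n × Fin d))

instance Idx.instDecidableEq (d : ℕ) : (n : ℕ) → DecidableEq (Idx d n)
  | 0 => inferInstanceAs (DecidableEq Unit)
  | n + 1 =>
    haveI := Idx.instDecidableEq d n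
    inferInstanceAs (DecidableEq (Idx d n × Fin d))

/-- The algebra `M_d(ℂ)^{⊗ n}`, that is, the first `n` factors
`M_d(ℂ)^{⊗ n} ⊗ I^{⊗ ∞}` of the infinite tensor product `𝒲 = M_d(ℂ)^{⊗ ∞}`. -/
abbrev W (d n : ℕ) : Type := Matrix (Idx d n) (Idx d n) ℂ

/-- The product state `ω = tr^{⊗ ∞}` on the first `n` factors: the normalized trace. -/
def omega (d n : ℕ) (x : W d n) : ℂ := ((d : ℂ) ^ n)⁻¹ * Matrix.trace x

/-- The inclusion `a ↦ a ⊗ I` of the first `n` factors in the first `n + 1` factors. -/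
def embed (d n : ℕ) : W d n →ₐ[ℂ] W d (n + 1) where
  toFun a := (a ⊗ₖ (1 : Matrix (Fin d) (Fin d) ℂ) :
    Matrix (Idx d n × Fin d) (Idx d n × Fin d) ℂ)
  map_one' := Matrix.one_kronecker_one
  map_mul' a b := by
    have h := Matrix.mul_kronecker_mul a b (1 : Matrix (Fin d) (Fin d) ℂ)
      (1 : Matrix (Fin d) (Fin d) ℂ)
    rw [mul_one] at h
    exact h
  map_zero' := Matrix.zero_kronecker _
  map_add' a b := Matrix.add_kronecker a b _
  commutes' r := by
    have h := Matrix.smul_kronecker r (1 : W d n) (1 : Matrix (Fin d) (Fin d) ℂ)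
    rw [Matrix.one_kronecker_one] at h
    rw [Algebra.algebraMap_eq_smul_one, Algebra.algebraMap_eq_smul_one]
    exact h

/-- The inclusion `b ↦ I^{⊗ n} ⊗ b` of the factor of rank `n + 1` in the first `n + 1`
factors. -/
def embedLast (d n : ℕ) : Matrix (Fin d) (Fin d) ℂ →ₐ[ℂ] W d (n + 1) where
  toFun b := ((1 : W d n) ⊗ₖ b : Matrix (Idx d n × Fin d) (Idx d n × Fin d) ℂ)
  map_one' := Matrix.one_kronecker_one
  map_mul' a b := by
    have h := Matrix.mul_kronecker_mul (1 : W d n) (1 : W d n) a b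
    rw [mul_one] at h
    exact h
  map_zero' := Matrix.kronecker_zero _
  map_add' a b := Matrix.kronecker_add _ a b
  commutes' r := by
    have h := Matrix.kronecker_smul r (1 : W d n) (1 : Matrix (Fin d) (Fin d) ℂ)
    rw [Matrix.one_kronecker_one] at h
    rw [Algebra.algebraMap_eq_smul_one, Algebra.algebraMap_eq_smul_one]
    exact h

theorem embed_commute (d n : ℕ) (a : W d n) (b : Matrix (Fin d) (Fin d) ℂ) :
    embed d n a * embedLast d n b = embedLast d n b * embed d n a := by
  have h₁ := Matrix.mul_kronecker_mul a (1 : W d n) (1 : Matrix (Fin d) (Fin d) ℂ) b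
  have h₂ := Matrix.mul_kronecker_mul (1 : W d n) a b (1 : Matrix (Fin d) (Fin d) ℂ)
  rw [mul_one, one_mul] at h₁ h₂
  exact h₁.symm.trans h₂

/-- The morphism `f ⊗ g : U d ⊗ U d → M_d(ℂ)^{⊗ n} ⊗ M_d(ℂ)` attached to two morphisms `f`, `g`. -/
def tensorHom (d n : ℕ) (f : U d →ₐ[ℂ] W d n) (g : U d →ₐ[ℂ] Matrix (Fin d) (Fin d) ℂ) :
    U d ⊗[ℂ] U d →ₐ[ℂ] W d (n + 1) :=
  Algebra.TensorProduct.lift ((embed d n).comp f) ((embedLast d n).comp g)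
    fun x y => embed_commute d n (f x) (g y)

theorem tensorHom_tmul (d n : ℕ) (f : U d →ₐ[ℂ] W d n)
    (g : U d →ₐ[ℂ] Matrix (Fin d) (Fin d) ℂ) (x y : U d) :
    tensorHom d n f g (x ⊗ₜ[ℂ] y) = embed d n (f x) * embedLast d n (g y) :=
  Algebra.TensorProduct.lift_tmul _ _ _ x y

/-- The morphisms `j_n = ρ^{⊗ n}`, defined by `ρ^{⊗ (n + 1)} = (ρ^{⊗ n} ⊗ ρ) ∘ Δ`.
For `n = 0` this is the trivial representation. -/
def j (d : ℕ) : (n : ℕ) → U d →ₐ[ℂ] W d n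
  | 0 => UniversalEnvelopingAlgebra.lift ℂ 0
  | n + 1 => (tensorHom d n (j d n) (rho d)).comp (coproduct d)

/-- The set `⋃_{1 ≤ k ≤ n} j_k(B)`, all of it seen in the first `n` factors. -/
def pastSet (d : ℕ) (B : Subalgebra ℂ (U d)) : (n : ℕ) → Set (W d n)
  | 0 => ∅
  | n + 1 => embed d n '' pastSet d B n ∪ j d (n + 1) '' (B : Set (U d))

/-- The von Neumann algebra generated by `j_k(B)`, `1 ≤ k ≤ n`, as the bicommutant in the algebra
`M_d(ℂ)^{⊗ n}` of all operators on `(ℂ^d)^{⊗ n}` (`StarSubalgebra.centralizer ℂ S` is the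
commutant of `S ∪ S*`). -/
def past (d : ℕ) (B : Subalgebra ℂ (U d)) (n : ℕ) : StarSubalgebra ℂ (W d n) :=
  StarSubalgebra.centralizer ℂ
    (StarSubalgebra.centralizer ℂ (pastSet d B n) : Set (W d n))

/-- The restriction of `(j_n)_{n ≥ 1}` to the subalgebra `B` is a quantum Markov chain: there is a
transition operator `Q : B → B` such that `ω(j_{n+1}(x) ξ) = ω(j_n(Q x) ξ)` for all `n ≥ 1`,
all `x ∈ B`, and all `ξ` in the von Neumann algebra generated by `j_k(B)`, `1 ≤ k ≤ n`. -/
def RestrictsToMarkov (d : ℕ) (B : Subalgebra ℂ (U d)) : Prop :=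
  ∃ Q : B →ₗ[ℂ] B, ∀ n : ℕ, 1 ≤ n → ∀ x : B, ∀ ξ ∈ past d B n,
    omega d (n + 1) (j d (n + 1) (x : U d) * embed d n ξ) =
      omega d n (j d n (Q x : U d) * ξ)

/-! ### The partition of `E = (e_{ij})` into blocks of sizes `d - 2`, `1`, `1` -/

/-- The matrix `E = (e_{ij})` with entries in `U d`. -/
def E (d : ℕ) : Matrix (Fin d) (Fin d) (U d) := Matrix.of (e d)

/-- The block (numbered `1`, `2` or `3`) of an index: the last index is in block `3`, the one
before it in block `2`, the others in block `1`. -/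
def blockOf (d : ℕ) (i : Fin d) : ℕ :=
  if (i : ℕ) + 2 < d then 1 else if (i : ℕ) + 2 = d then 2 else 3

/-- The block `E_{rs}` of `E`. -/
def block (d r s : ℕ) :
    Matrix {i : Fin d // blockOf d i = r} {i : Fin d // blockOf d i = s} (U d) :=
  (E d).submatrix Subtype.val Subtype.val

/-- The subalgebra generated by the constants and the `Tr (E_{11}^k)`,
`Tr ([[E_{11}, E_{12}], [E_{21}, E_{22}]]^k)` and `Tr (E^k)`, `k ∈ ℕ`. -/
def minorAlgebra (d : ℕ) : Subalgebra ℂ (U d) :=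
  Algebra.adjoin ℂ
    (Set.range (fun k : ℕ => Matrix.trace (block d 1 1 ^ k)) ∪
      Set.range (fun k : ℕ => Matrix.trace
        (Matrix.fromBlocks (block d 1 1) (block d 1 2) (block d 2 1) (block d 2 2) ^ k)) ∪
      Set.range (fun k : ℕ => Matrix.trace (E d ^ k)))

/-- The element `E_{21} E_{12} (E_{31} E_{13} + E_{32} E_{23})²`; each product of blocks in it is a
`1 × 1` matrix, identified with its only entry through the trace. -/
def witness (d : ℕ) : U d :=
  Matrix.trace (block d 2 1 * block d 1 2) *
    (Matrix.trace (block d 3 1 * block d 1 3) + Matrix.trace (block d 3 2 * block d 2 3)) ^ 2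

end QuantumMinors

end

namespace QuantumMinors

open Matrix

/-! Write m and n for the labels of blocks 2 and 3, S for the labels of block 1, and x = E₂₁E₁₂ =
`rowCol d m S`. The obstruction is that x lies in 𝓑 and commutes with all of 𝓑
(`commute_rowCol_minorAlgebra`). If b ∈ 𝓑, cyclicity of the trace gives Tr(j₃(b)[j₃(x), ζ]) =
Tr([j₃(b), j₃(x)]ζ) = 0 for every ζ. A transition operator Q would therefore force ω(j₄(a)[j₃(x),
ζ]) = ω(j₃(Qa)[j₃(x), ζ]) = 0 for every ζ in the past at time 3.

The test operator ζ = ∑_{k ∈ S} |m n k⟩⟨k m n| belongs to that past, being a product of operators of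
the process at times 1, 2 and 3 (`testOp_apply`, `testOp_mem_past`). Yet the trace of j₄(a) against
[j₃(x), ζ] ⊗ I equals |S|(2|S| - 1) ≠ 0 (`trace_j_four_mul_embed`). The same number excludes Pa ∈ 𝓑,
since `trace_j_succ_mul_embed` expresses it as d · Tr(j₃(Pa)[j₃(x), ζ]). -/

/-! ### Commutation relations in the enveloping algebra. -/

theorem e_mul_e (d : ℕ) (i k r s : Fin d) :
    e d i k * e d r s = e d r s * e d i k +
      ((if k = r then e d i s else 0) - (if s = i then e d r k else 0)) := by
  have h := (UniversalEnvelopingAlgebra.ι ℂ (L := Matrix (Fin d) (Fin d) ℂ)).map_lie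
    (Matrix.single i k 1) (Matrix.single r s 1)
  rw [LieRing.of_associative_ring_bracket, LieRing.of_associative_ring_bracket] at h
  have h₁ : Matrix.single i k (1 : ℂ) * Matrix.single r s 1 =
      if k = r then Matrix.single i s 1 else 0 := by
    split_ifs with h
    · subst h; simp
    · simp [Matrix.single_mul_single_of_ne, h]
  have h₂ : Matrix.single r s (1 : ℂ) * Matrix.single i k 1 =
      if s = i then Matrix.single r k 1 else 0 := by
    split_ifs with h
    · subst h; simp
    · simp [Matrix.single_mul_single_of_ne, h]
  rw [h₁, h₂, map_sub] at h
  rw [← sub_eq_iff_eq_add']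
  unfold e
  rw [← h]
  congr 1 <;> split_ifs <;> simp

/-- The powers of a principal submatrix of `E` transform under `𝔤𝔩` like `E` does. -/
theorem e_mul_submatrix_pow (d : ℕ) {κ : Type*} [Fintype κ] [DecidableEq κ] (f : κ → Fin d)
    (hf : Function.Injective f) (p : ℕ) (k l i j : κ) :
    e d (f k) (f l) * ((E d).submatrix f f ^ p) i j =
      ((E d).submatrix f f ^ p) i j * e d (f k) (f l) +
        ((if l = i then ((E d).submatrix f f ^ p) k j else 0) -
          (if j = k then ((E d).submatrix f f ^ p) i l else 0)) := by
  induction p generalizing i j with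
  | zero =>
    simp only [pow_zero, Matrix.one_apply]
    by_cases h₁ : i = j <;> by_cases h₂ : l = i <;> by_cases h₃ : j = k <;> simp_all [eq_comm]
  | succ p ih =>
    simp only [pow_succ, Matrix.mul_apply, Finset.mul_sum, Finset.sum_mul]
    have key : ∀ q, e d (f k) (f l) *
          (((E d).submatrix f f ^ p) i q * (E d).submatrix f f q j) =
        ((E d).submatrix f f ^ p) i q * (E d).submatrix f f q j * e d (f k) (f l) +
        ((if l = i then ((E d).submatrix f f ^ p) k q * (E d).submatrix f f q j else 0) -
          (if q = k then ((E d).submatrix f f ^ p) i l * (E d).submatrix f f q j else 0) +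
        ((if l = q then ((E d).submatrix f f ^ p) i q * (E d).submatrix f f k j else 0) -
          (if j = k then ((E d).submatrix f f ^ p) i q * (E d).submatrix f f q l else 0))) := by
      intro q
      rw [← mul_assoc, ih, add_mul, mul_assoc]
      have := e_mul_e d (f k) (f l) (f q) (f j)
      simp only [Matrix.submatrix_apply, E, Matrix.of_apply, this, hf.eq_iff, sub_mul, mul_add,
        mul_sub, ite_mul, mul_ite, zero_mul, mul_zero, mul_assoc]
      abel
    -- After summation over q, the terms q = k and q = l both give (M^p)_{il} M_{kj}, with opposite
    -- signs, and cancel.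
    simp only [key, Finset.sum_add_distrib, Finset.sum_sub_distrib, Finset.sum_ite_eq,
      Finset.sum_ite_eq', Finset.mem_univ, if_true]
    by_cases h₁ : l = i <;> by_cases h₂ : j = k <;> simp [h₁, h₂, sub_eq_add_neg]

/-- Traces of powers are the Gelfand invariants, central in the enveloping algebra of the block: on
the diagonal, the two correction terms of `e_mul_submatrix_pow` both sum to (M^p)_{kl}. -/
theorem commute_e_trace_submatrix_pow (d : ℕ) {κ : Type*} [Fintype κ] [DecidableEq κ]
    (f : κ → Fin d) (hf : Function.Injective f) (p : ℕ) (k l : κ) :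
    Commute (e d (f k) (f l)) (((E d).submatrix f f ^ p).trace) := by
  simp only [Commute, SemiconjBy, Matrix.trace, Matrix.diag_apply, Finset.mul_sum, Finset.sum_mul,
    e_mul_submatrix_pow d f hf, Finset.sum_add_distrib, Finset.sum_sub_distrib,
    Finset.sum_ite_eq, Finset.sum_ite_eq', Finset.mem_univ, if_true, sub_self, add_zero]

/-- An element commuting with all entries of a matrix commutes with the traces of its powers. -/
theorem commute_trace_pow {R κ : Type*} [Ring R] [Fintype κ] [DecidableEq κ] (x : R)
    (M : Matrix κ κ R) (h : ∀ i k, Commute x (M i k)) (p : ℕ) : Commute x ((M ^ p).trace) := by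
  have hp : ∀ i k, Commute x ((M ^ p) i k) := by
    induction p with
    | zero =>
      intro i k
      rw [pow_zero, Matrix.one_apply]
      split_ifs
      exacts [Commute.one_right _, Commute.zero_right _]
    | succ p ih =>
      intro i k
      rw [pow_succ, Matrix.mul_apply]
      exact Commute.sum_right _ _ _ fun q _ => (ih i q).mul_right (h q k)
  exact Commute.sum_right _ _ _ fun i _ => hp i i

/-- The element `∑_{k ∈ S} e_{rk} e_{kr}`. -/
noncomputable def rowCol (d : ℕ) (r : Fin d) (S : Finset (Fin d)) : U d :=
  ∑ k ∈ S, e d r k * e d k r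

/-- The sum contracts the row (e_{ri}) with the column (e_{ir}), which are dual to each other under
𝔤𝔩(S). Each Leibniz term contributes e_{rl} e_{kr}, with opposite signs. -/
theorem commute_e_rowCol (d : ℕ) (r : Fin d) (S : Finset (Fin d)) (hr : r ∉ S) (k l : Fin d)
    (hk : k ∈ S) (hl : l ∈ S) : Commute (rowCol d r S) (e d k l) := by
  have hkr : k ≠ r := fun h => hr (h ▸ hk)
  have hlr : l ≠ r := fun h => hr (h ▸ hl)
  have key : ∀ i, e d k l * (e d r i * e d i r) = e d r i * e d i r * e d k l +
      ((if l = i then e d r i * e d k r else 0) - (if i = k then e d r l * e d i r else 0)) := by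
    intro i
    rw [← mul_assoc, e_mul_e d k l r i, add_mul, mul_assoc, e_mul_e d k l i r]
    simp only [hlr, hkr.symm, if_false, sub_zero, zero_sub, mul_add, mul_ite, mul_zero, neg_mul,
      ite_mul, zero_mul, mul_assoc]
    abel
  symm
  simp only [Commute, SemiconjBy, rowCol, Finset.mul_sum, Finset.sum_mul, key,
    Finset.sum_add_distrib, Finset.sum_sub_distrib, Finset.sum_ite_eq, Finset.sum_ite_eq', hk, hl,
    if_true, sub_self, add_zero]

theorem commute_rowCol (d : ℕ) (r : Fin d) (S : Finset (Fin d)) (x : U d)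
    (h : ∀ k ∈ S, Commute (e d r k) x ∧ Commute (e d k r) x) : Commute (rowCol d r S) x :=
  Commute.sum_left _ _ _ fun k hk => (h k hk).1.mul_left (h k hk).2

/-- The trace of a squared block contains the products in both orders; this reduces them to one
order modulo diagonal elements. -/
theorem sum_mul_comm_rowCol (d : ℕ) (r : Fin d) (S : Finset (Fin d)) :
    ∑ k ∈ S, e d k r * e d r k = rowCol d r S + (∑ k ∈ S, e d k k - S.card • e d r r) := by
  have h : ∀ k ∈ S, e d k r * e d r k = e d r k * e d k r + (e d k k - e d r r) := by
    intro k hk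
    rw [e_mul_e d k r r k]
    simp
  rw [Finset.sum_congr rfl h, Finset.sum_add_distrib, Finset.sum_sub_distrib, Finset.sum_const,
    rowCol]

/-! ### The action of j_n in coordinates. -/

/-- Appends a label to the index of a basis vector of `(ℂ^d)^{⊗ n}`. -/
def snoc {d n : ℕ} (f : Idx d n) (t : Fin d) : Idx d (n + 1) := (f, t)

/-- The only index of a basis vector of `(ℂ^d)^{⊗ 0}`. -/
def emptyIdx (d : ℕ) : Idx d 0 := ()

theorem sum_idx_succ (d n : ℕ) {M : Type*} [AddCommMonoid M] (F : Idx d (n + 1) → M) :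
    ∑ x, F x = ∑ f : Idx d n, ∑ t : Fin d, F (snoc f t) :=
  Fintype.sum_prod_type (α₁ := Idx d n) (α₂ := Fin d) F

theorem embed_apply (d n : ℕ) (M : W d n) (f g : Idx d n) (s t : Fin d) :
    embed d n M (snoc f s) (snoc g t) = M f g * (1 : Matrix (Fin d) (Fin d) ℂ) s t := rfl

theorem embedLast_apply (d n : ℕ) (b : Matrix (Fin d) (Fin d) ℂ) (f g : Idx d n) (s t : Fin d) :
    embedLast d n b (snoc f s) (snoc g t) = (1 : W d n) f g * b s t := rfl

theorem embed_mulVec (d n : ℕ) (M : W d n) (w : Idx d (n + 1) → ℂ) (f : Idx d n) (t : Fin d) :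
    (embed d n M *ᵥ w) (snoc f t) = (M *ᵥ fun g => w (snoc g t)) f := by
  simp [Matrix.mulVec, dotProduct, sum_idx_succ, embed_apply, Matrix.one_apply]

theorem embedLast_mulVec (d n : ℕ) (k l : Fin d) (w : Idx d (n + 1) → ℂ) (f : Idx d n)
    (t : Fin d) :
    (embedLast d n (Matrix.single k l 1) *ᵥ w) (snoc f t) = if t = k then w (snoc f l) else 0 := by
  simp only [Matrix.mulVec, dotProduct, sum_idx_succ, embedLast_apply, Matrix.one_apply,
    Matrix.single_apply]
  by_cases h : t = k
  · subst h; simp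
  · simp [h, Ne.symm h]

theorem j_zero_ι (d : ℕ) (x : Matrix (Fin d) (Fin d) ℂ) :
    j d 0 (UniversalEnvelopingAlgebra.ι ℂ x) = 0 := by
  rw [j, UniversalEnvelopingAlgebra.lift_ι_apply]
  rfl

theorem j_succ_ι (d n : ℕ) (x : Matrix (Fin d) (Fin d) ℂ) :
    j d (n + 1) (UniversalEnvelopingAlgebra.ι ℂ x) =
      embed d n (j d n (UniversalEnvelopingAlgebra.ι ℂ x)) + embedLast d n x := by
  rw [j, AlgHom.comp_apply, coproduct, UniversalEnvelopingAlgebra.lift_ι_apply, primitive_apply,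
    map_add, tensorHom_tmul, tensorHom_tmul, rho, UniversalEnvelopingAlgebra.lift_ι_apply,
    map_one, map_one, map_one, map_one, one_mul, mul_one]
  exact add_comm _ _

theorem j_succ_e_mulVec (d n : ℕ) (k l : Fin d) (w : Idx d (n + 1) → ℂ) (f : Idx d n)
    (t : Fin d) :
    (j d (n + 1) (e d k l) *ᵥ w) (snoc f t) =
      (j d n (e d k l) *ᵥ fun g => w (snoc g t)) f + if t = k then w (snoc f l) else 0 := by
  rw [e, j_succ_ι, Matrix.add_mulVec, Pi.add_apply, embed_mulVec, embedLast_mulVec]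

theorem j_zero_e_mulVec (d : ℕ) (k l : Fin d) (w : Idx d 0 → ℂ) :
    j d 0 (e d k l) *ᵥ w = 0 := by
  rw [e, j_zero_ι, Matrix.zero_mulVec]

/-! ### Conditional expectation and the past algebra. -/

/-- The conditional expectation onto the first `n` factors maps `j_{n+1}(x)` to `j_n(P x)`. -/
theorem trace_j_succ_mul_embed (d n : ℕ) (hd : d ≠ 0) (x : U d) (ξ : W d n) :
    (j d (n + 1) x * embed d n ξ).trace = d * (j d n (P d x) * ξ).trace := by
  have key : ∀ z : U d ⊗[ℂ] U d, (tensorHom d n (j d n) (rho d) z * embed d n ξ).trace =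
      d * (j d n ((TensorProduct.rid ℂ (U d)) ((eta d).lTensor (U d) z)) * ξ).trace := by
    intro z
    induction z using TensorProduct.induction_on with
    | zero => simp
    | add a b ha hb => simp only [map_add, add_mul, Matrix.trace_add, mul_add, ha, hb]
    | tmul a b =>
      -- Operators on different factors commute, so the trace splits into a trace over the first n
      -- factors times one over the last. The factor d undoes the normalization in `eta`.
      rw [tensorHom_tmul, mul_assoc, ← embed_commute, ← mul_assoc, ← map_mul]
      have h : (embed d n (j d n a * ξ) * embedLast d n (rho d b)).trace =
          (j d n a * ξ).trace * (rho d b).trace := by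
        have h₁ := Matrix.mul_kronecker_mul (j d n a * ξ) (1 : W d n) (1 : Matrix (Fin d) (Fin d) ℂ)
          (rho d b)
        rw [mul_one, one_mul] at h₁
        rw [← Matrix.trace_kronecker, h₁]
        rfl
      rw [h, LinearMap.lTensor_tmul, TensorProduct.rid_tmul, map_smul, Matrix.smul_mul,
        Matrix.trace_smul, eta]
      have : (d : ℂ) ≠ 0 := by exact_mod_cast hd
      simp only [LinearMap.smul_apply, LinearMap.comp_apply, AlgHom.toLinearMap_apply,
        Matrix.traceLinearMap_apply, smul_eq_mul]
      field_simp
  exact key (coproduct d x)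

theorem pastSet_subset_past (d : ℕ) (B : Subalgebra ℂ (U d)) (n : ℕ) :
    pastSet d B n ⊆ past d B n := by
  intro x hx
  change x ∈ past d B n
  rw [past, StarSubalgebra.mem_centralizer_iff]
  intro g hg
  -- Membership in the bicommutant asks for commutation with g and with its adjoint.
  have hs := star_mem (S := StarSubalgebra ℂ (W d n)) hg
  rw [SetLike.mem_coe, StarSubalgebra.mem_centralizer_iff] at hg
  rw [StarSubalgebra.mem_centralizer_iff] at hs
  exact ⟨(hg x hx).1.symm, (hs x hx).1.symm⟩

theorem j_mem_past (d n : ℕ) (B : Subalgebra ℂ (U d)) (x : U d) (hx : x ∈ B) :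
    j d (n + 1) x ∈ past d B (n + 1) :=
  pastSet_subset_past d B _ (Or.inr ⟨x, hx, rfl⟩)

/-! ### Explicit matrix entries on three and four tensor factors. -/

/-- The basis vector of `(ℂ^d)^{⊗ 3}` with the given labels. -/
def tuple₃ {d : ℕ} (a b c : Fin d) : Idx d 3 := snoc (snoc (snoc (emptyIdx d) a) b) c

/-- The basis vector of `(ℂ^d)^{⊗ 4}` with the given labels. -/
def tuple₄ {d : ℕ} (a b c t : Fin d) : Idx d 4 := snoc (tuple₃ a b c) t

theorem tuple₃_inj {d : ℕ} {a b c a' b' c' : Fin d} :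
    tuple₃ a b c = tuple₃ a' b' c' ↔ a = a' ∧ b = b' ∧ c = c' := by
  refine ⟨fun h => ?_, by rintro ⟨rfl, rfl, rfl⟩; rfl⟩
  have h₁ := Prod.ext_iff.1 h
  have h₂ := Prod.ext_iff.1 h₁.1
  exact ⟨(Prod.ext_iff.1 h₂.1).2, h₂.2, h₁.2⟩

theorem tuple₄_inj {d : ℕ} {a b c t a' b' c' t' : Fin d} :
    tuple₄ a b c t = tuple₄ a' b' c' t' ↔ a = a' ∧ b = b' ∧ c = c' ∧ t = t' := by
  refine ⟨fun h => ?_, by rintro ⟨rfl, rfl, rfl, rfl⟩; rfl⟩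
  have h₁ := Prod.ext_iff.1 h
  have h₂ := tuple₃_inj.1 h₁.1
  exact ⟨h₂.1, h₂.2.1, h₂.2.2, h₁.2⟩

theorem sum_idx_three (d : ℕ) {M : Type*} [AddCommMonoid M] (F : Idx d 3 → M) :
    ∑ x, F x = ∑ a, ∑ b, ∑ c, F (tuple₃ a b c) := by
  rw [sum_idx_succ, sum_idx_succ, sum_idx_succ]
  exact Fintype.sum_unique (ι := Unit) _

theorem j_three_e_mulVec (d : ℕ) (k l : Fin d) (w : Idx d 3 → ℂ) (a b c : Fin d) :
    (j d 3 (e d k l) *ᵥ w) (tuple₃ a b c) =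
      (if a = k then w (tuple₃ l b c) else 0) + (if b = k then w (tuple₃ a l c) else 0) +
        (if c = k then w (tuple₃ a b l) else 0) := by
  rw [tuple₃, j_succ_e_mulVec, j_succ_e_mulVec, j_succ_e_mulVec, j_zero_e_mulVec]
  simp [tuple₃]

theorem j_four_e_mulVec (d : ℕ) (k l : Fin d) (w : Idx d 4 → ℂ) (a b c t : Fin d) :
    (j d 4 (e d k l) *ᵥ w) (tuple₄ a b c t) =
      (if a = k then w (tuple₄ l b c t) else 0) + (if b = k then w (tuple₄ a l c t) else 0) +
        (if c = k then w (tuple₄ a b l t) else 0) + (if t = k then w (tuple₄ a b c l) else 0) := by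
  rw [tuple₄, j_succ_e_mulVec, j_three_e_mulVec]
  rfl

/-- In ∑ e_{rk} e_{kr}, both factors acting on one slot with label r give the multiplicity |S|;
acting on two different slots, they exchange a label r with a label in S. -/
theorem j_three_rowCol_mulVec (d : ℕ) (r : Fin d) (S : Finset (Fin d)) (w : Idx d 3 → ℂ)
    (a b c : Fin d) :
    (j d 3 (rowCol d r S) *ᵥ w) (tuple₃ a b c) =
      (if a = r then S.card * w (tuple₃ r b c) + (if b ∈ S then w (tuple₃ b r c) else 0) +
        (if c ∈ S then w (tuple₃ c b r) else 0) else 0) +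
      (if b = r then S.card * w (tuple₃ a r c) + (if a ∈ S then w (tuple₃ r a c) else 0) +
        (if c ∈ S then w (tuple₃ a c r) else 0) else 0) +
      (if c = r then S.card * w (tuple₃ a b r) + (if a ∈ S then w (tuple₃ r b a) else 0) +
        (if b ∈ S then w (tuple₃ a r b) else 0) else 0) := by
  simp only [rowCol, map_sum, map_mul, Matrix.sum_mulVec, Finset.sum_apply, ← Matrix.mulVec_mulVec,
    j_three_e_mulVec, if_true, Finset.sum_add_distrib]
  congr 1
  · congr 1
    · split_ifs <;> simp_all [Finset.sum_add_distrib]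
    · split_ifs <;> simp_all [Finset.sum_add_distrib] <;> ring
  · split_ifs <;> simp_all [Finset.sum_add_distrib] <;> ring

theorem j_four_rowCol_mulVec (d : ℕ) (r : Fin d) (S : Finset (Fin d)) (w : Idx d 4 → ℂ)
    (a b c t : Fin d) :
    (j d 4 (rowCol d r S) *ᵥ w) (tuple₄ a b c t) =
      (if a = r then S.card * w (tuple₄ r b c t) + (if b ∈ S then w (tuple₄ b r c t) else 0) +
        (if c ∈ S then w (tuple₄ c b r t) else 0) +
        (if t ∈ S then w (tuple₄ t b c r) else 0) else 0) +
      (if b = r then S.card * w (tuple₄ a r c t) + (if a ∈ S then w (tuple₄ r a c t) else 0) +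
        (if c ∈ S then w (tuple₄ a c r t) else 0) +
        (if t ∈ S then w (tuple₄ a t c r) else 0) else 0) +
      (if c = r then S.card * w (tuple₄ a b r t) + (if a ∈ S then w (tuple₄ r b a t) else 0) +
        (if b ∈ S then w (tuple₄ a r b t) else 0) +
        (if t ∈ S then w (tuple₄ a b t r) else 0) else 0) +
      (if t = r then S.card * w (tuple₄ a b c r) + (if a ∈ S then w (tuple₄ r b c a) else 0) +
        (if b ∈ S then w (tuple₄ a r c b) else 0) +
        (if c ∈ S then w (tuple₄ a b r c) else 0) else 0) := by
  simp only [rowCol, map_sum, map_mul, Matrix.sum_mulVec, Finset.sum_apply, ← Matrix.mulVec_mulVec,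
    j_four_e_mulVec, if_true, Finset.sum_add_distrib]
  congr 1
  · congr 1
    · congr 1
      · split_ifs <;> simp_all [Finset.sum_add_distrib]
      · split_ifs <;> simp_all [Finset.sum_add_distrib] <;> ring
    · split_ifs <;> simp_all [Finset.sum_add_distrib] <;> ring
  · split_ifs <;> simp_all [Finset.sum_add_distrib] <;> ring

theorem embed_j_three_rowCol_mulVec (d : ℕ) (r : Fin d) (S : Finset (Fin d)) (w : Idx d 4 → ℂ)
    (a b c t : Fin d) :
    (embed d 3 (j d 3 (rowCol d r S)) *ᵥ w) (tuple₄ a b c t) =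
      (if a = r then S.card * w (tuple₄ r b c t) + (if b ∈ S then w (tuple₄ b r c t) else 0) +
        (if c ∈ S then w (tuple₄ c b r t) else 0) else 0) +
      (if b = r then S.card * w (tuple₄ a r c t) + (if a ∈ S then w (tuple₄ r a c t) else 0) +
        (if c ∈ S then w (tuple₄ a c r t) else 0) else 0) +
      (if c = r then S.card * w (tuple₄ a b r t) + (if a ∈ S then w (tuple₄ r b a t) else 0) +
        (if b ∈ S then w (tuple₄ a r b t) else 0) else 0) :=
  (embed_mulVec d 3 _ w (tuple₃ a b c) t).trans
    (j_three_rowCol_mulVec d r S (fun g => w (snoc g t)) a b c)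

/-- Turns an entry of a product of operators into their successive action on a basis vector, where
the coordinate formulas apply. -/
theorem matrix_apply_eq_mulVec {κ R : Type*} [Fintype κ] [DecidableEq κ] [CommRing R]
    (M : Matrix κ κ R) (f g : κ) : M f g = (M *ᵥ Pi.single g 1) f := by
  rw [Matrix.mulVec_single_one]; rfl

set_option maxHeartbeats 2000000 in
/-- For any operator `X` acting like `j_3(∑_{k ∈ S} e_{mk} e_{km}) ⊗ I`, the entries of its
commutator with `j_4(a)` that contribute to the trace against the test operator. -/
theorem commutator_apply_tuple₄ (d : ℕ) (m n i t : Fin d) (S T : Finset (Fin d)) (hmn : m ≠ n)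
    (hi : i ∈ S) (hm : m ∉ S) (hn : n ∉ S) (hT : T = insert m S)
    (ht : t = m ∨ t = n ∨ t ∈ S) (X : W d 4)
    (hX : ∀ (w : Idx d 4 → ℂ) (a b c t : Fin d), (X *ᵥ w) (tuple₄ a b c t) =
      (if a = m then S.card * w (tuple₄ m b c t) + (if b ∈ S then w (tuple₄ b m c t) else 0) +
        (if c ∈ S then w (tuple₄ c b m t) else 0) else 0) +
      (if b = m then S.card * w (tuple₄ a m c t) + (if a ∈ S then w (tuple₄ m a c t) else 0) +
        (if c ∈ S then w (tuple₄ a c m t) else 0) else 0) +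
      (if c = m then S.card * w (tuple₄ a b m t) + (if a ∈ S then w (tuple₄ m b a t) else 0) +
        (if b ∈ S then w (tuple₄ a m b t) else 0) else 0)) :
    (j d 4 (rowCol d m S * rowCol d n T ^ 2) * X -
        X * j d 4 (rowCol d m S * rowCol d n T ^ 2)) (tuple₄ i m n t) (tuple₄ m n i t) =
      1 + (if t = n then -1 else 0) + (if t = m then 2 * (S.card : ℂ) - 2 else 0) +
        (if t = i then -(S.card : ℂ) else 0) := by
  have him : i ≠ m := fun h => hm (h ▸ hi)
  have hin : i ≠ n := fun h => hn (h ▸ hi)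
  have hc : (T.card : ℂ) = S.card + 1 := by
    rw [hT, Finset.card_insert_of_notMem hm]; push_cast; rfl
  have hmT : m ∈ T := by simp [hT]
  have hiT : i ∈ T := by simp [hT, hi]
  have hnT : n ∉ T := by simp [hT, hn, hmn.symm]
  refine (matrix_apply_eq_mulVec _ _ _).trans ?_
  simp only [map_mul, pow_two, Matrix.sub_mulVec, Pi.sub_apply, ← Matrix.mulVec_mulVec]
  -- The entry depends on t only through whether t is m, n, i or another label of S.
  rcases ht with rfl | rfl | ht
  · simp only [hX, j_four_rowCol_mulVec, Pi.single_apply, tuple₄_inj,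
      hi, hm, hn, hmT, hiT, hnT, hmn, hmn.symm, him, him.symm, hin, hin.symm, if_true, if_false,
      and_true, and_false, zero_add, add_zero, mul_zero, mul_one]
    rw [hc]; ring
  · simp only [hX, j_four_rowCol_mulVec, Pi.single_apply, tuple₄_inj,
      hi, hm, hn, hmT, hiT, hnT, hmn, hmn.symm, him, him.symm, hin, hin.symm, if_true, if_false,
      and_true, and_false, zero_add, add_zero, mul_zero, mul_one]
    rw [hc]; ring
  · have htm : t ≠ m := fun h => hm (h ▸ ht)
    have htn : t ≠ n := fun h => hn (h ▸ ht)
    have htT : t ∈ T := by simp [hT, ht]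
    by_cases hti : t = i
    · subst hti
      simp only [hX, j_four_rowCol_mulVec, Pi.single_apply, tuple₄_inj,
        hi, hm, hn, hmT, hiT, hnT, hmn, hmn.symm, him, him.symm, hin, hin.symm, if_true, if_false,
        and_true, and_false, zero_add, add_zero, mul_zero, mul_one]
      rw [hc]; ring
    · simp only [hX, j_four_rowCol_mulVec, Pi.single_apply, tuple₄_inj,
        hi, hm, hn, hmT, hiT, hnT, hmn, hmn.symm, him, him.symm, hin, hin.symm, if_true, if_false,
        and_true, and_false, zero_add, add_zero, mul_zero, mul_one,
        ht, htm, htn, htT, hti, Ne.symm htm, Ne.symm htn, Ne.symm hti]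
      rw [hc]; ring

/-! ### The test operator. -/

theorem embed_embed_j_one_mulVec (d : ℕ) (r : Fin d) (w : Idx d 3 → ℂ) (a b c : Fin d) :
    (embed d 2 (embed d 1 (j d 1 (e d r r))) *ᵥ w) (tuple₃ a b c) =
      if a = r then w (tuple₃ r b c) else 0 := by
  rw [tuple₃, embed_mulVec, embed_mulVec, j_succ_e_mulVec, j_zero_e_mulVec]
  simp [tuple₃]

theorem embed_j_two_mulVec (d : ℕ) (r : Fin d) (w : Idx d 3 → ℂ) (a b c : Fin d) :
    (embed d 2 (j d 2 (e d r r)) *ᵥ w) (tuple₃ a b c) =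
      (if a = r then w (tuple₃ r b c) else 0) + if b = r then w (tuple₃ a r c) else 0 := by
  rw [tuple₃, embed_mulVec, j_succ_e_mulVec, j_succ_e_mulVec, j_zero_e_mulVec]
  simp [tuple₃]

/-- Read from the left on row labels: D_m J_n keeps only (m, n, c). The next two factors exchange
labels, and 1 - D_m - D_n requires a first label in S, which forces the exchange to (c, n, m) with c
∈ S. From there the T-sum reaches (c, n, m), (n, c, m) and (c, m, n). The second has first label n,
and J_m, counting m in positions 1 and 2, kills the first and gives (c, m, n) coefficient 1. -/
theorem testProduct_apply (d : ℕ) (m n : Fin d) (S T : Finset (Fin d)) (hmn : m ≠ n)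
    (hm : m ∉ S) (hn : n ∉ S) (hT : T = insert m S) (hS : ∀ k, k = m ∨ k = n ∨ k ∈ S)
    (D J : Fin d → W d 3)
    (hD : ∀ r w a b c, (D r *ᵥ w) (tuple₃ a b c) = if a = r then w (tuple₃ r b c) else 0)
    (hJ : ∀ r w a b c, (J r *ᵥ w) (tuple₃ a b c) =
        (if a = r then w (tuple₃ r b c) else 0) + if b = r then w (tuple₃ a r c) else 0)
    (a b c x y z : Fin d) :
    (D m * J n * j d 3 (rowCol d m S) * j d 3 (rowCol d n T) * (1 - D m - D n) * J m)
        (tuple₃ a b c) (tuple₃ x y z) =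
      if a = m then if b = n then if m = y then if n = z then if c = x then if c ∈ S then 1 else 0
        else 0 else 0 else 0 else 0 else 0 := by
  have hmT : m ∈ T := by simp [hT]
  have hnT : n ∉ T := by simp [hT, hn, hmn.symm]
  refine (matrix_apply_eq_mulVec _ _ _).trans ?_
  simp only [← Matrix.mulVec_mulVec]
  by_cases ha : a = m
  swap
  · simp only [hD, ha, if_false]
  by_cases hb : b = n
  swap
  · simp only [hD, hJ, ha, hb, hmn, if_false, add_zero, ite_self]
  subst ha hb
  rcases hS c with rfl | rfl | hc
  · simp only [hD, hJ, j_three_rowCol_mulVec, Matrix.sub_mulVec, Matrix.one_mulVec, Pi.sub_apply,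
      Pi.single_apply, tuple₃_inj, hm, hn, hmT, hnT, hmn, hmn.symm, if_true, if_false, zero_add,
      add_zero, mul_zero, sub_self, sub_zero, ite_self]
  · simp only [hD, hJ, j_three_rowCol_mulVec, Matrix.sub_mulVec, Matrix.one_mulVec, Pi.sub_apply,
      Pi.single_apply, tuple₃_inj, hm, hn, hmT, hnT, hmn, hmn.symm, if_true, if_false, zero_add,
      add_zero, mul_zero, sub_self, sub_zero, ite_self]
  · have hcm : c ≠ a := fun h => hm (h ▸ hc)
    have hcn : c ≠ b := fun h => hn (h ▸ hc)
    have hcT : c ∈ T := by simp [hT, hc]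
    simp only [hD, hJ, j_three_rowCol_mulVec, Matrix.sub_mulVec, Matrix.one_mulVec, Pi.sub_apply,
      Pi.single_apply, tuple₃_inj, hm, hn, hmT, hnT, hmn, hmn.symm, if_true, if_false, zero_add,
      add_zero, mul_zero, sub_self, sub_zero, hc, hcm, hcn, hcT]
    by_cases h₁ : a = y <;> by_cases h₂ : b = z <;> by_cases h₃ : c = x <;>
      simp [h₁, h₂, h₃]

/-- The projection on the vectors with label `r` in position `1`. -/
noncomputable def firstLabel (d : ℕ) (r : Fin d) : W d 3 :=
  embed d 2 (embed d 1 (j d 1 (e d r r)))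

/-- The number of labels `r` in positions `1` and `2`. -/
noncomputable def countLabel (d : ℕ) (r : Fin d) : W d 3 :=
  embed d 2 (j d 2 (e d r r))

/-- The operator `∑_{k ∈ S} |m n k⟩⟨k m n|` on `(ℂ^d)^{⊗ 3}`, written in terms of the process. -/
noncomputable def testOp (d : ℕ) (m n : Fin d) (S T : Finset (Fin d)) : W d 3 :=
  firstLabel d m * countLabel d n * j d 3 (rowCol d m S) * j d 3 (rowCol d n T) *
    (1 - firstLabel d m - firstLabel d n) * countLabel d m

theorem testOp_apply (d : ℕ) (m n : Fin d) (S T : Finset (Fin d)) (hmn : m ≠ n)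
    (hm : m ∉ S) (hn : n ∉ S) (hT : T = insert m S) (hS : ∀ k, k = m ∨ k = n ∨ k ∈ S)
    (a b c x y z : Fin d) :
    testOp d m n S T (tuple₃ a b c) (tuple₃ x y z) =
      if a = m then if b = n then if m = y then if n = z then if c = x then if c ∈ S then 1 else 0
        else 0 else 0 else 0 else 0 else 0 :=
  testProduct_apply d m n S T hmn hm hn hT hS (firstLabel d) (countLabel d)
    (embed_embed_j_one_mulVec d) (embed_j_two_mulVec d) a b c x y z

theorem trace_mul_embed_testOp (d : ℕ) (m n : Fin d) (S T : Finset (Fin d)) (hmn : m ≠ n)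
    (hm : m ∉ S) (hn : n ∉ S) (hT : T = insert m S) (hS : ∀ k, k = m ∨ k = n ∨ k ∈ S)
    (M : W d 4) :
    (M * embed d 3 (testOp d m n S T)).trace =
      ∑ i ∈ S, ∑ t, M (tuple₄ i m n t) (tuple₄ m n i t) := by
  have h : (M * embed d 3 (testOp d m n S T)).trace = ∑ g : Idx d 3, ∑ f : Idx d 3,
      (∑ t, M (snoc g t) (snoc f t)) * testOp d m n S T f g := by
    rw [Matrix.trace, sum_idx_succ]
    refine Finset.sum_congr rfl fun g _ => ?_
    simp only [Finset.sum_mul]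
    rw [Finset.sum_comm]
    refine Finset.sum_congr rfl fun t _ => ?_
    rw [Matrix.diag_apply, Matrix.mul_apply, sum_idx_succ]
    refine Finset.sum_congr rfl fun f _ => ?_
    simp [embed_apply, Matrix.one_apply]
  rw [h]
  simp only [sum_idx_three, testOp_apply d m n S T hmn hm hn hT hS, mul_ite, mul_one, mul_zero,
    Finset.sum_ite_eq, Finset.sum_ite_eq', Finset.mem_univ, if_true, Finset.sum_ite_irrel,
    Finset.sum_const_zero, Finset.sum_ite_mem]
  rw [Finset.univ_inter]
  rfl

/-- Trace of a matrix against a commutator, with the commutator moved to the other factor. -/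
theorem trace_mul_commutator {κ : Type*} [Fintype κ] (A X Z : Matrix κ κ ℂ) :
    (A * (X * Z - Z * X)).trace = ((A * X - X * A) * Z).trace := by
  rw [mul_sub, sub_mul, Matrix.trace_sub, Matrix.trace_sub, ← mul_assoc, ← mul_assoc,
    Matrix.trace_mul_comm (A * Z) X, mul_assoc X A Z]

/-- The nonzero number that contradicts the Markov property. -/
theorem trace_j_four_mul_embed (d : ℕ) (m n : Fin d) (S T : Finset (Fin d)) (hmn : m ≠ n)
    (hm : m ∉ S) (hn : n ∉ S) (hT : T = insert m S) (hS : ∀ k, k = m ∨ k = n ∨ k ∈ S)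
    (hd : d = S.card + 2) :
    (j d 4 (rowCol d m S * rowCol d n T ^ 2) *
      embed d 3 (j d 3 (rowCol d m S) * testOp d m n S T -
        testOp d m n S T * j d 3 (rowCol d m S))).trace = S.card * (2 * S.card - 1) := by
  -- The commutator is moved from the test operator onto j₄(a), so that only the entries computed in
  -- `commutator_apply_tuple₄` remain.
  have h : ∀ (A X : W d 4) (Y : W d 3), embed d 3 Y = X →
      (A * embed d 3 (Y * testOp d m n S T - testOp d m n S T * Y)).trace =
        ∑ i ∈ S, ∑ t, (A * X - X * A) (tuple₄ i m n t) (tuple₄ m n i t) := by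
    rintro A X Y rfl
    rw [map_sub, map_mul, map_mul]
    exact (trace_mul_commutator _ _ _).trans
      (trace_mul_embed_testOp d m n S T hmn hm hn hT hS _)
  refine (h _ _ _ rfl).trans ?_
  have key : ∀ i ∈ S, ∑ t, (j d 4 (rowCol d m S * rowCol d n T ^ 2) *
        (show W d 4 from embed d 3 (j d 3 (rowCol d m S))) -
        (show W d 4 from embed d 3 (j d 3 (rowCol d m S))) *
          j d 4 (rowCol d m S * rowCol d n T ^ 2)) (tuple₄ i m n t) (tuple₄ m n i t) =
      2 * (S.card : ℂ) - 1 := by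
    intro i hi
    refine (Finset.sum_congr rfl fun t _ => commutator_apply_tuple₄ d m n i t S T hmn hi hm hn hT
      (hS t) _ (embed_j_three_rowCol_mulVec d m S)).trans ?_
    -- The sum over t is d - 1 + (2|S| - 2) - |S|, which is 2|S| - 1 because d = |S| + 2.
    simp only [Finset.sum_add_distrib, Finset.sum_ite_eq', Finset.mem_univ, if_true,
      Finset.sum_const, Finset.card_univ, Fintype.card_fin, nsmul_eq_mul, mul_one]
    have : (d : ℂ) = S.card + 2 := by exact_mod_cast hd
    rw [this]
    ring
  exact (Finset.sum_congr rfl key).trans (by rw [Finset.sum_const, nsmul_eq_mul])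

/-! ### Vanishing on commuting elements, and membership in the past and in the subalgebra. -/

/-- Commuting elements are not detected by commutators. -/
theorem trace_j_mul_commutator (d n : ℕ) (b x : U d) (h : Commute x b) (Z : W d n) :
    (j d n b * (j d n x * Z - Z * j d n x)).trace = 0 := by
  rw [trace_mul_commutator, ← map_mul, ← map_mul, h.eq, sub_self, zero_mul, Matrix.trace_zero]

/-- The label operators are j₁(e_{rr}) and j₂(e_{rr}), and the two exchange factors are taken at
time 3: it is the use of different times that brings in operators outside j₃(B). -/
theorem testOp_mem_past (d : ℕ) (m n : Fin d) (S T : Finset (Fin d)) (B : Subalgebra ℂ (U d))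
    (hm : e d m m ∈ B) (hn : e d n n ∈ B) (hX : rowCol d m S ∈ B) (hY : rowCol d n T ∈ B) :
    testOp d m n S T ∈ past d B 3 := by
  have hD : ∀ r, e d r r ∈ B → firstLabel d r ∈ past d B 3 := fun r hr =>
    pastSet_subset_past d B 3 (Or.inl ⟨_, Or.inl ⟨_, Or.inr ⟨_, hr, rfl⟩, rfl⟩, rfl⟩)
  have hJ : ∀ r, e d r r ∈ B → countLabel d r ∈ past d B 3 := fun r hr =>
    pastSet_subset_past d B 3 (Or.inl ⟨_, Or.inr ⟨_, hr, rfl⟩, rfl⟩)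
  exact mul_mem (mul_mem (mul_mem (mul_mem (mul_mem (hD m hm) (hJ n hn)) (j_mem_past d 2 B _ hX))
    (j_mem_past d 2 B _ hY)) (sub_mem (sub_mem (one_mem _) (hD m hm)) (hD n hn))) (hJ m hm)

/-- Enlarging a block by r changes Tr M by e_{rr}, and Tr M² by e_{rr}² plus the row-column products
in both orders. Reordering leaves twice `rowCol d r R` modulo elements of B. -/
theorem e_rowCol_mem (d : ℕ) (B : Subalgebra ℂ (U d)) (r : Fin d) (R : Finset (Fin d))
    (hr : r ∉ R) (h₁ : ∑ k ∈ R, e d k k ∈ B) (h₂ : ∑ i ∈ R, ∑ k ∈ R, e d i k * e d k i ∈ B)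
    (h₁' : ∑ k ∈ insert r R, e d k k ∈ B)
    (h₂' : ∑ i ∈ insert r R, ∑ k ∈ insert r R, e d i k * e d k i ∈ B) :
    e d r r ∈ B ∧ rowCol d r R ∈ B := by
  have he : e d r r ∈ B := by
    rw [Finset.sum_insert hr] at h₁'
    simpa using sub_mem h₁' h₁
  refine ⟨he, ?_⟩
  simp only [Finset.sum_insert hr, Finset.sum_add_distrib, sum_mul_comm_rowCol] at h₂'
  have h : rowCol d r R + rowCol d r R ∈ B := by
    have := sub_mem (sub_mem (sub_mem h₂' h₂) (mul_mem he he))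
      (sub_mem h₁ (nsmul_mem he R.card))
    convert this using 1
    rw [rowCol]
    abel
  rw [← two_smul ℂ] at h
  simpa [smul_smul] using B.smul_mem h (2⁻¹ : ℂ)

theorem trace_submatrix_mem (d : ℕ) {κ : Type*} [Fintype κ] [DecidableEq κ] (f : κ → Fin d)
    (R : Finset (Fin d)) (hR : ∀ F : Fin d → U d, ∑ x, F (f x) = ∑ k ∈ R, F k)
    (B : Subalgebra ℂ (U d)) (hB : ∀ p, ((E d).submatrix f f ^ p).trace ∈ B) :
    ∑ k ∈ R, e d k k ∈ B ∧ ∑ i ∈ R, ∑ k ∈ R, e d i k * e d k i ∈ B := by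
  constructor
  · rw [← hR]
    simpa [Matrix.trace, E] using hB 1
  · rw [← hR]
    simp only [← hR]
    simpa [Matrix.trace, E, pow_two, Matrix.mul_apply] using hB 2

/-! ### The block partition and the element commuting with 𝓑. -/

section Blocks

variable {d : ℕ}

theorem blockOf_eq_two_iff (m k : Fin d) (hm : (m : ℕ) + 2 = d) : blockOf d k = 2 ↔ k = m := by
  rw [Fin.ext_iff, blockOf]
  split_ifs <;> simp <;> omega

theorem blockOf_eq_three_iff (n k : Fin d) (hn : (n : ℕ) + 1 = d) :
    blockOf d k = 3 ↔ k = n := by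
  rw [Fin.ext_iff, blockOf]
  split_ifs <;> simp <;> omega

theorem sum_blockOf_eq_one {M : Type*} [AddCommMonoid M] (F : Fin d → M) :
    ∑ x : {i : Fin d // blockOf d i = 1}, F x =
      ∑ k ∈ Finset.univ.filter (fun k => blockOf d k = 1), F k :=
  (Finset.sum_subtype _ (by simp) F).symm

theorem sum_blockOf_eq_two {M : Type*} [AddCommMonoid M] (m : Fin d) (hm : (m : ℕ) + 2 = d)
    (F : Fin d → M) : ∑ x : {i : Fin d // blockOf d i = 2}, F x = F m := by
  rw [← Finset.sum_subtype {m} (by simp [blockOf_eq_two_iff m _ hm]) F, Finset.sum_singleton]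

theorem sum_blockOf_eq_three {M : Type*} [AddCommMonoid M] (n : Fin d) (hn : (n : ℕ) + 1 = d)
    (F : Fin d → M) : ∑ x : {i : Fin d // blockOf d i = 3}, F x = F n := by
  rw [← Finset.sum_subtype {n} (by simp [blockOf_eq_three_iff n _ hn]) F, Finset.sum_singleton]

theorem witness_eq (m n : Fin d) (hm : (m : ℕ) + 2 = d) (hn : (n : ℕ) + 1 = d)
    (S : Finset (Fin d)) (hS : S = Finset.univ.filter (fun k => blockOf d k = 1)) (hmS : m ∉ S) :
    witness d = rowCol d m S * rowCol d n (insert m S) ^ 2 := by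
  rw [witness, rowCol, rowCol, Finset.sum_insert hmS, hS]
  simp only [Matrix.trace, Matrix.diag_apply, Matrix.mul_apply, block, Matrix.submatrix_apply,
    E, Matrix.of_apply]
  rw [sum_blockOf_eq_two m hm (fun x => ∑ y : {i : Fin d // blockOf d i = 1}, e d x y * e d y x),
    sum_blockOf_eq_one (fun y => e d m y * e d y m),
    sum_blockOf_eq_three n hn (fun x => ∑ y : {i : Fin d // blockOf d i = 1}, e d x y * e d y x),
    sum_blockOf_eq_one (fun y => e d n y * e d y n),
    sum_blockOf_eq_three n hn (fun x => ∑ y : {i : Fin d // blockOf d i = 2}, e d x y * e d y x),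
    sum_blockOf_eq_two m hm (fun y => e d n y * e d y n), add_comm (e d n m * e d m n)]

/-- The inclusion of the first two blocks of indices. -/
def firstBlocks (d : ℕ) : {i : Fin d // blockOf d i = 1} ⊕ {i : Fin d // blockOf d i = 2} → Fin d :=
  Sum.elim Subtype.val Subtype.val

theorem firstBlocks_injective : Function.Injective (firstBlocks d) :=
  Subtype.val_injective.sumElim Subtype.val_injective fun a b h => by
    have h₁ := a.2
    rw [h, b.2] at h₁
    norm_num at h₁

theorem fromBlocks_eq_submatrix :
    Matrix.fromBlocks (block d 1 1) (block d 1 2) (block d 2 1) (block d 2 2) =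
      (E d).submatrix (firstBlocks d) (firstBlocks d) := by
  ext (i | i) (k | k) <;> rfl

theorem trace_block_one_mem (p : ℕ) :
    ((E d).submatrix (Subtype.val : {i : Fin d // blockOf d i = 1} → Fin d) Subtype.val ^ p).trace ∈
      minorAlgebra d :=
  Algebra.subset_adjoin (Or.inl (Or.inl ⟨p, rfl⟩))

theorem trace_firstBlocks_mem (p : ℕ) :
    ((E d).submatrix (firstBlocks d) (firstBlocks d) ^ p).trace ∈ minorAlgebra d := by
  rw [← fromBlocks_eq_submatrix]
  exact Algebra.subset_adjoin (Or.inl (Or.inr ⟨p, rfl⟩))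

theorem trace_E_mem (p : ℕ) : ((E d).submatrix id id ^ p).trace ∈ minorAlgebra d :=
  Algebra.subset_adjoin (Or.inr ⟨p, rfl⟩)

/-- The element is a 𝔤𝔩(S)-invariant, so it commutes with the entries of E₁₁. It is also a
polynomial in generators of 𝔤𝔩_{d-1}, hence commutes with the Gelfand invariants of 𝔤𝔩_{d-1} and of
𝔤𝔩_d. -/
theorem commute_rowCol_minorAlgebra (m : Fin d) (hm : (m : ℕ) + 2 = d) (S : Finset (Fin d))
    (hS : S = Finset.univ.filter (fun k => blockOf d k = 1)) (hmS : m ∉ S) (b : U d)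
    (hb : b ∈ minorAlgebra d) : Commute (rowCol d m S) b := by
  have hmem : ∀ k, k ∈ S ↔ blockOf d k = 1 := by simp [hS]
  refine Algebra.adjoin_induction (p := fun x _ => Commute (rowCol d m S) x) ?_
    (fun r => Algebra.commute_algebraMap_right r _) (fun _ _ _ _ h h' => h.add_right h')
    (fun _ _ _ _ h h' => h.mul_right h') hb
  rintro _ ((⟨p, rfl⟩ | ⟨p, rfl⟩) | ⟨p, rfl⟩)
  · refine commute_trace_pow (rowCol d m S) (block d 1 1) (fun i k => ?_) p
    exact commute_e_rowCol d m S hmS i.1 k.1 ((hmem _).2 i.2) ((hmem _).2 k.2)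
  · simp only [fromBlocks_eq_submatrix]
    refine commute_rowCol d m S _ fun k hk => ?_
    let x : {i : Fin d // blockOf d i = 2} := ⟨m, (blockOf_eq_two_iff m m hm).2 rfl⟩
    let y : {i : Fin d // blockOf d i = 1} := ⟨k, (hmem k).1 hk⟩
    exact ⟨commute_e_trace_submatrix_pow d _ firstBlocks_injective p (Sum.inr x) (Sum.inl y),
      commute_e_trace_submatrix_pow d _ firstBlocks_injective p (Sum.inl y) (Sum.inr x)⟩
  · exact commute_rowCol d m S _ fun k _ =>
      ⟨commute_e_trace_submatrix_pow d id Function.injective_id p m k,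
        commute_e_trace_submatrix_pow d id Function.injective_id p k m⟩

end Blocks

end QuantumMinors

open QuantumMinors in
theorem mainTheorem2 (d : ℕ) (hd : 3 ≤ d) :
    ¬ QuantumMinors.RestrictsToMarkov d (QuantumMinors.minorAlgebra d) ∧
      QuantumMinors.witness d ∈ QuantumMinors.minorAlgebra d ∧
      QuantumMinors.P d (QuantumMinors.witness d) ∉ QuantumMinors.minorAlgebra d := by
  obtain ⟨m, hm⟩ : ∃ m : Fin d, (m : ℕ) + 2 = d := ⟨⟨d - 2, by omega⟩, by simp; omega⟩
  obtain ⟨n, hn⟩ : ∃ n : Fin d, (n : ℕ) + 1 = d := ⟨⟨d - 1, by omega⟩, by simp; omega⟩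
  obtain ⟨S, hS⟩ : ∃ S, S = Finset.univ.filter (fun k => blockOf d k = 1) := ⟨_, rfl⟩
  have hmem : ∀ k, k ∈ S ↔ blockOf d k = 1 := by simp [hS]
  have hmn : m ≠ n := by rintro rfl; omega
  have hmS : m ∉ S := by simp [hmem, (blockOf_eq_two_iff m m hm).2 rfl]
  have hnS : n ∉ S := by simp [hmem, (blockOf_eq_three_iff n n hn).2 rfl]
  have hnT : n ∉ insert m S := by simp [hnS, hmn.symm]
  have hall : ∀ k, k = m ∨ k = n ∨ k ∈ S := by
    intro k
    rw [← blockOf_eq_two_iff m k hm, ← blockOf_eq_three_iff n k hn, hmem, blockOf]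
    split_ifs <;> simp
  have huniv : insert n (insert m S) = Finset.univ := by
    ext k
    have := hall k
    simp only [Finset.mem_insert, Finset.mem_univ, iff_true]
    tauto
  have hcard : d = S.card + 2 := by
    have := congrArg Finset.card huniv
    rw [Finset.card_insert_of_notMem hnT, Finset.card_insert_of_notMem hmS, Finset.card_univ,
      Fintype.card_fin] at this
    omega
  have h₁ := trace_submatrix_mem d _ S (fun F => by rw [hS, sum_blockOf_eq_one F]) _
    (trace_block_one_mem (d := d))
  have h₂ := trace_submatrix_mem d (firstBlocks d) (insert m S) (fun F => by
    rw [Fintype.sum_sum_type, Finset.sum_insert hmS, add_comm, hS, ← sum_blockOf_eq_one F,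
      ← sum_blockOf_eq_two m hm F]
    rfl) _ (trace_firstBlocks_mem (d := d))
  have h₃ := trace_submatrix_mem d id (insert n (insert m S)) (fun F => by rw [huniv]; rfl) _
    (trace_E_mem (d := d))
  obtain ⟨hem, hX⟩ := e_rowCol_mem d _ m S hmS h₁.1 h₁.2 h₂.1 h₂.2
  obtain ⟨hen, hY⟩ := e_rowCol_mem d _ n _ hnT h₂.1 h₂.2 h₃.1 h₃.2
  have hw := witness_eq m n hm hn S hS hmS
  have hwB : witness d ∈ minorAlgebra d := hw ▸ mul_mem hX (pow_mem hY 2)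
  have hcomm := commute_rowCol_minorAlgebra m hm S hS hmS
  have htrace := trace_j_four_mul_embed d m n S _ hmn hmS hnS rfl hall hcard
  rw [← hw] at htrace
  -- Here d ≥ 3 gives |S| ≥ 1, and 2|S| ≠ 1 by parity.
  have hne : (S.card : ℂ) * (2 * S.card - 1) ≠ 0 := by
    refine mul_ne_zero (by norm_cast; omega) (sub_ne_zero.2 ?_)
    norm_cast
    omega
  have hd0 : (d : ℂ) ≠ 0 := by norm_cast; omega
  refine ⟨?_, hwB, fun hP => ?_⟩
  · rintro ⟨Q, hQ⟩
    have hζ := testOp_mem_past d m n S _ _ hem hen hX hY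
    have hX₃ := j_mem_past d 2 _ _ hX
    -- The Markov identity at time 3 with ξ = [j₃(x), ζ]: its right side vanishes because Qa
    -- commutes with x.
    have h := hQ 3 (by norm_num) ⟨_, hwB⟩ _ (sub_mem (mul_mem hX₃ hζ) (mul_mem hζ hX₃))
    rw [omega, omega, trace_j_mul_commutator d 3 _ _ (hcomm _ (Q ⟨_, hwB⟩).2), mul_zero] at h
    exact hne (htrace.symm.trans ((mul_eq_zero.1 h).resolve_left (inv_ne_zero (pow_ne_zero _ hd0))))
  -- The same argument with Pa in place of Qa; the trace identity for P needs no membership in 𝓑.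
  · have h := trace_j_succ_mul_embed d 3 (by omega) (witness d)
      (j d 3 (rowCol d m S) * testOp d m n S (insert m S) -
        testOp d m n S (insert m S) * j d 3 (rowCol d m S))
    rw [trace_j_mul_commutator d 3 _ _ (hcomm _ hP), mul_zero] at h
    exact hne (htrace.symm.trans h)
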